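/- Let $L$ be a field. An $L$-bimodule $P$ is an abelian group with commuting left and right $L$-vector space structures (which need not coincide). For $a\in L$ let $\phi_P(a)\in \mathrm{End}_L(P)$ be the endomorphism $x\mapsto xa$ of the left $L$-vector space $P$. The center of $P$ is $\mathcal Z(P)=\{z\in L : zx=xz \text{ for all } x\in P\}$. The bimodule $P$ is called a Galois bimodule of rank $d\ge 1$ if $P\cong L^d$ as a left $L$-vector space, $P\cong L^d$ as a right $L$-vector space, and $P\otimes_L P\cong P^d$ as $L$-bimodules, where $P\otimes_L P$ is formed with the right action on the first factor and the left action on the second. Let $P$ be a Galois bimodule of rank $d$ over $L$ and let $a\in L$. Then the characteristic polynomial $\chi_a$ of $\phi_P(a)$ (over $L$, with respect to the left vector space structure on $P$) is a power $\mu_a^r$, $r\ge 1$, of the minimal polynomial $\mu_a$ of $\phi_P(a)$ over $L$, and all coefficients of $\chi_a$ belong to $\mathcal Z(P)$. -/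

import Mathlib

open scoped TensorProduct
open MulOpposite

namespace GalBimod

/-- For a commutative ring `A`, an `A`-bimodule is an abelian group `P` with a left action
`[Module A P]` and a right action `[Module Aᵐᵒᵖ P]` (so that `x a` is `op a • x`) which commute
with each other, `[SMulCommClass A Aᵐᵒᵖ P]`. The two actions need not coincide.

`RightMod A P` is `P` regarded as an `A`-module through its right action. -/
@[nolint unusedArguments]
def RightMod (A P : Type*) [CommRing A] [AddCommGroup P] [Module Aᵐᵒᵖ P] : Type _ := P

namespace RightMod

variable {A P : Type*} [CommRing A] [AddCommGroup P] [Module Aᵐᵒᵖ P]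

instance : AddCommGroup (RightMod A P) := inferInstanceAs (AddCommGroup P)

instance : Module A (RightMod A P) :=
  Module.compHom P (RingEquiv.toOpposite A).toRingHom

variable (A P)

/-- The identity map from `P` to `RightMod A P`. -/
def of : P ≃+ RightMod A P := AddEquiv.refl P

variable {P} in
theorem smul_of (a : A) (x : P) : a • of A P x = of A P (op a • x) := rfl

/-- The left multiplications `x ↦ a x` of a bimodule, as endomorphisms of the right module. -/
def leftMul [Module A P] [SMulCommClass A Aᵐᵒᵖ P] :
    A →+* Module.End A (RightMod A P) where
  toFun a :=
    { toFun := fun x => of A P (a • (of A P).symm x)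
      map_add' := fun x y => by rw [map_add, smul_add, map_add]
      map_smul' := fun b x =>
        congrArg (of A P) (smul_comm a (op b) ((of A P).symm x)) }
  map_one' := LinearMap.ext fun x => congrArg (of A P) (one_smul A ((of A P).symm x))
  map_mul' a b := LinearMap.ext fun x => congrArg (of A P) (mul_smul a b ((of A P).symm x))
  map_zero' := LinearMap.ext fun x => congrArg (of A P) (zero_smul A ((of A P).symm x))
  map_add' a b := LinearMap.ext fun x => congrArg (of A P) (add_smul a b ((of A P).symm x))

variable {P} in
theorem leftMul_of [Module A P] [SMulCommClass A Aᵐᵒᵖ P] (a : A) (x : P) :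
    leftMul A P a (of A P x) = of A P (a • x) := rfl

end RightMod

/-- The right action homomorphism `φ_P` of a bimodule: `φ_P a` is the endomorphism `x ↦ x a` of
the left module `P`. -/
def phi (A P : Type*) [CommRing A] [AddCommGroup P] [Module A P] [Module Aᵐᵒᵖ P]
    [SMulCommClass A Aᵐᵒᵖ P] : A →+* Module.End A P where
  toFun a :=
    { toFun := fun x => op a • x
      map_add' := fun x y => smul_add (op a) x y
      map_smul' := fun b x => (smul_comm b (op a) x).symm }
  map_one' := LinearMap.ext fun x => one_smul Aᵐᵒᵖ x
  map_mul' a b := LinearMap.ext fun x => by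
    change op (a * b) • x = op a • op b • x
    rw [mul_comm, op_mul, mul_smul]
  map_zero' := LinearMap.ext fun x => zero_smul Aᵐᵒᵖ x
  map_add' a b := LinearMap.ext fun x => add_smul (op a) (op b) x

/-- The center of a bimodule `P`: all `z` with `z x = x z` for every `x` in `P`. -/
def center (A P : Type*) [CommRing A] [AddCommGroup P] [Module A P] [Module Aᵐᵒᵖ P]
    [SMulCommClass A Aᵐᵒᵖ P] : Subring A where
  carrier := {z | ∀ x : P, z • x = op z • x}
  mul_mem' := fun {a b} ha hb x => by
    rw [mul_smul, hb x, smul_comm, ha x, ← mul_smul, ← op_mul]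
  one_mem' := fun x => by simp
  add_mem' := fun {a b} ha hb x => by rw [add_smul, ha x, hb x, op_add, add_smul]
  zero_mem' := fun x => by simp
  neg_mem' := fun {a} ha x => by rw [neg_smul, ha x, op_neg, neg_smul]

/-- The tensor product `P ⊗_A Q` of two bimodules: the right action on `P` is balanced against the
left action on `Q`. It is again a bimodule, through the left action on `P` and the right action
on `Q`. -/
def BimodTensor (A P Q : Type*) [CommRing A] [AddCommGroup P] [Module Aᵐᵒᵖ P]
    [AddCommGroup Q] [Module A Q] : Type _ := RightMod A P ⊗[A] Q

namespace BimodTensor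

variable {A P Q : Type*} [CommRing A] [AddCommGroup P] [Module Aᵐᵒᵖ P]
  [AddCommGroup Q] [Module A Q]

instance : AddCommGroup (BimodTensor A P Q) :=
  inferInstanceAs (AddCommGroup (RightMod A P ⊗[A] Q))

/-- The pure tensor `p ⊗ q`. -/
def tmul (p : P) (q : Q) : BimodTensor A P Q := RightMod.of A P p ⊗ₜ[A] q

theorem balanced (a : A) (p : P) (q : Q) :
    (tmul (op a • p) q : BimodTensor A P Q) = tmul p (a • q) :=
  TensorProduct.smul_tmul a (RightMod.of A P p) q

/-- The left action: `a (p ⊗ q) = (a p) ⊗ q`. -/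
instance leftModule [Module A P] [SMulCommClass A Aᵐᵒᵖ P] :
    Module A (BimodTensor A P Q) :=
  Module.compHom (RightMod A P ⊗[A] Q)
    ((Module.End.rTensorAlgHom A (RightMod A P) Q).toRingHom.comp (RightMod.leftMul A P))

/-- The right action: `(p ⊗ q) a = p ⊗ (q a)`. -/
instance rightModule [Module Aᵐᵒᵖ Q] [SMulCommClass A Aᵐᵒᵖ Q] :
    Module Aᵐᵒᵖ (BimodTensor A P Q) :=
  Module.compHom (RightMod A P ⊗[A] Q)
    ((Module.End.lTensorAlgHom A Q (RightMod A P)).toRingHom.comp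
      ((phi A Q).comp (RingEquiv.toOpposite A).symm.toRingHom))

theorem smul_tmul [Module A P] [SMulCommClass A Aᵐᵒᵖ P] (a : A) (p : P) (q : Q) :
    a • (tmul p q : BimodTensor A P Q) = tmul (a • p) q := rfl

theorem op_smul_tmul [Module Aᵐᵒᵖ Q] [SMulCommClass A Aᵐᵒᵖ Q] (a : A) (p : P) (q : Q) :
    op a • (tmul p q : BimodTensor A P Q) = tmul p (op a • q) := rfl

/-- The two actions on `P ⊗_A Q` commute, so `P ⊗_A Q` is again a bimodule. -/
instance [Module A P] [SMulCommClass A Aᵐᵒᵖ P] [Module Aᵐᵒᵖ Q] [SMulCommClass A Aᵐᵒᵖ Q] :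
    SMulCommClass A Aᵐᵒᵖ (BimodTensor A P Q) where
  smul_comm a b t := by
    obtain ⟨c, rfl⟩ := op_surjective b
    exact LinearMap.congr_fun (TensorProduct.ext' fun (_ : RightMod A P) (_ : Q) => rfl :
      (RightMod.leftMul A P a).rTensor Q ∘ₗ (phi A Q c).lTensor (RightMod A P) =
        (phi A Q c).lTensor (RightMod A P) ∘ₗ (RightMod.leftMul A P a).rTensor Q) t

end BimodTensor

/-- An additive map between bimodules is a bimodule map if it commutes with both actions. -/
def IsBimodMap (A : Type*) {M N : Type*} [CommRing A]
    [AddCommGroup M] [Module A M] [Module Aᵐᵒᵖ M]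
    [AddCommGroup N] [Module A N] [Module Aᵐᵒᵖ N] (f : M →+ N) : Prop :=
  (∀ (a : A) (x : M), f (a • x) = a • f x) ∧ (∀ (a : A) (x : M), f (op a • x) = op a • f x)

/-- A weakly Galois bimodule of rank `d ≥ 1`: isomorphic to `A^d` as a left module and as a right
module, and such that `P ⊗_A P` embeds into some `P^N` as a bimodule. -/
structure IsWeaklyGalois (A : Type*) (d : ℕ) (P : Type*) [CommRing A] [AddCommGroup P]
    [Module A P] [Module Aᵐᵒᵖ P] [SMulCommClass A Aᵐᵒᵖ P] : Prop where
  one_le_rank : 1 ≤ d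
  left_free : Nonempty (P ≃ₗ[A] (Fin d → A))
  right_free : Nonempty (P ≃ₗ[Aᵐᵒᵖ] (Fin d → A))
  tensor_embeds : ∃ (N : ℕ) (f : BimodTensor A P P →+ (Fin N → P)),
    IsBimodMap A f ∧ Function.Injective f

/-- A Galois bimodule of rank `d`: a weakly Galois bimodule of rank `d` for which moreover
`P ⊗_A P` is isomorphic to `P^d` as a bimodule. -/
structure IsGalois (A : Type*) (d : ℕ) (P : Type*) [CommRing A] [AddCommGroup P]
    [Module A P] [Module Aᵐᵒᵖ P] [SMulCommClass A Aᵐᵒᵖ P] : Prop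
    extends IsWeaklyGalois A d P where
  tensor_iso : ∃ e : BimodTensor A P P ≃+ (Fin d → P), IsBimodMap A e.toAddMonoidHom

/-- A weakly Galois bimodule is finitely generated as a left module. -/
theorem IsWeaklyGalois.finite {A : Type*} {d : ℕ} {P : Type*} [CommRing A] [AddCommGroup P]
    [Module A P] [Module Aᵐᵒᵖ P] [SMulCommClass A Aᵐᵒᵖ P] (h : IsWeaklyGalois A d P) :
    Module.Finite A P :=
  h.left_free.elim fun e => Module.Finite.equiv e.symm

end GalBimod

set_option linter.unusedSectionVars false

/-! In a left basis of `P` the right action is a matrix representation φ : L → M_d(L). Applying φ to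
every entry of φ(a) gives the right action on P ⊗ P, so the bimodule isomorphism P ⊗ P ≅ P^d says
that φ(φ(a)) is conjugate, uniformly in a, to d copies of φ(a) (`IsGalois.exists_conj`).

Let Z be the field of z for which φ(z) is the scalar matrix z; these z lie in the center of `P`. The
conjugacy makes the left L-span of the coordinate functions of φ closed under composition. A
Jacobson–Bourbaki argument then gives n = [L : Z] < ∞ and shows that φ sends a Z-basis of L to
L-independent matrices (`exists_basis_scalarField`). Hence left multiplication by φ(b) on M_d(L),
which is d copies of φ(b), contains the regular representation of L over Z, with a quotient κ of
dimension q = d² - n (`exists_conj_fromBlocks`).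

Let m be the minimal polynomial of a over Z, k its degree and C its companion matrix. Substituting
these representations into φ(a) compares d² copies of φ(a) with copies of C plus κ(φ(a)). The κ term
is controlled by repeating the comparison for every Z-linear ν in place of the inclusion of scalars
and taking an infimum of normalized ranks. The outcome is d · rank g(C) ≤ k · rank g(φ(a)) for all
polynomials g, even over the algebraic closure (`card_mul_rank_companionMatrix_le`).

Since rank g(C) ≥ k - deg g for g ≠ 0, no proper divisor of m kills φ(a), so m is the minimal
polynomial of φ(a). For a root α of m, the choice g = m/(X - α) bounds from below the number of
largest Jordan blocks at α. Comparing multiplicities and degrees forces the characteristic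
polynomial to be a power of m, whose coefficients lie in Z. -/

namespace GalBimod

open Matrix Polynomial

/-! ### Similarity of matrices -/

section Similarity

variable {R : Type*} [CommRing R]
variable {ι κ τ o s : Type*} [Fintype ι] [Fintype κ] [Fintype τ] [Fintype o] [Fintype s]
  [DecidableEq ι] [DecidableEq κ] [DecidableEq τ] [DecidableEq o] [DecidableEq s]

/-- Similarity of square matrices whose index types may differ. -/
def Sim (A : Matrix ι ι R) (B : Matrix κ κ R) : Prop :=
  ∃ (S : Matrix κ ι R) (S' : Matrix ι κ R), S * S' = 1 ∧ S' * S = 1 ∧ S * A = B * S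

theorem Sim.symm {A : Matrix ι ι R} {B : Matrix κ κ R} (h : Sim A B) : Sim B A := by
  obtain ⟨S, S', h₁, h₂, h₃⟩ := h
  refine ⟨S', S, h₂, h₁, ?_⟩
  calc S' * B = S' * (B * S) * S' := by simp only [Matrix.mul_assoc, h₁, Matrix.mul_one]
    _ = (S' * S) * A * S' := by rw [← h₃]; simp only [Matrix.mul_assoc]
    _ = A * S' := by rw [h₂, Matrix.one_mul]

theorem Sim.trans {A : Matrix ι ι R} {B : Matrix κ κ R} {C : Matrix τ τ R}
    (h : Sim A B) (h' : Sim B C) : Sim A C := by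
  obtain ⟨S, S', h₁, h₂, h₃⟩ := h
  obtain ⟨T, T', k₁, k₂, k₃⟩ := h'
  refine ⟨T * S, S' * T', ?_, ?_, ?_⟩
  · rw [Matrix.mul_assoc, ← Matrix.mul_assoc S, h₁, Matrix.one_mul, k₁]
  · rw [Matrix.mul_assoc, ← Matrix.mul_assoc T', k₂, Matrix.one_mul, h₂]
  · rw [Matrix.mul_assoc, h₃, ← Matrix.mul_assoc, k₃, Matrix.mul_assoc]

theorem sim_of_equiv {A : Matrix ι ι R} {B : Matrix κ κ R} (e : ι ≃ κ)
    (h : ∀ i j, B (e i) (e j) = A i j) : Sim A B := by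
  have hA : A = B.submatrix e e := by ext i j; exact (h i j).symm
  refine ⟨(1 : Matrix κ κ R).submatrix id e, (1 : Matrix κ κ R).submatrix e id, ?_, ?_, ?_⟩
  · rw [Matrix.submatrix_mul_equiv]; simp
  · rw [← Matrix.submatrix_mul _ _ e id e Function.bijective_id]; simp
  · rw [hA, Matrix.submatrix_mul_equiv, Matrix.one_mul]
    ext i j
    simp [Matrix.mul_apply, Matrix.one_apply]

theorem sim_toMatrix {M : Type*} [AddCommGroup M] [Module R M] (b : Module.Basis ι R M)
    (c : Module.Basis κ R M) (f : M →ₗ[R] M) :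
    Sim (LinearMap.toMatrix b b f) (LinearMap.toMatrix c c f) :=
  ⟨c.toMatrix b, b.toMatrix c, c.toMatrix_mul_toMatrix_flip b, b.toMatrix_mul_toMatrix_flip c, by
    rw [basis_toMatrix_mul_linearMap_toMatrix, linearMap_toMatrix_mul_basis_toMatrix]⟩

theorem Sim.blockDiagonal {A : Matrix ι ι R} {B : Matrix κ κ R} (h : Sim A B) :
    Sim (blockDiagonal fun _ : o => A) (blockDiagonal fun _ : o => B) := by
  obtain ⟨S, S', h₁, h₂, h₃⟩ := h
  refine ⟨Matrix.blockDiagonal fun _ => S, Matrix.blockDiagonal fun _ => S', ?_, ?_, ?_⟩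
  · rw [← blockDiagonal_mul, h₁]; exact blockDiagonal_one
  · rw [← blockDiagonal_mul, h₂]; exact blockDiagonal_one
  · rw [← blockDiagonal_mul, h₃, blockDiagonal_mul]

theorem mul_aeval_of_mul_eq {A : Matrix ι ι R} {B : Matrix κ κ R} {S : Matrix κ ι R}
    (h : S * A = B * S) (g : R[X]) : S * aeval A g = aeval B g * S := by
  induction g using Polynomial.induction_on' with
  | add p q hp hq => rw [map_add, map_add, Matrix.mul_add, Matrix.add_mul, hp, hq]
  | monomial n c =>
    have hn : S * A ^ n = B ^ n * S := by
      induction n with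
      | zero => simp
      | succ n ih => rw [pow_succ, ← Matrix.mul_assoc, ih, Matrix.mul_assoc, h, pow_succ,
          Matrix.mul_assoc]
    rw [aeval_monomial, aeval_monomial, ← Algebra.smul_def, ← Algebra.smul_def, Matrix.mul_smul,
      hn, Matrix.smul_mul]

end Similarity

/-! ### Ranks of polynomials in block matrices -/

section Rank

variable {K : Type*} [Field K]
variable {ι κ τ o s : Type*} [Fintype ι] [Fintype κ] [Fintype τ] [Fintype o] [Fintype s]
  [DecidableEq ι] [DecidableEq κ] [DecidableEq τ] [DecidableEq o] [DecidableEq s]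

theorem Sim.rank_aeval_le {A : Matrix ι ι K} {B : Matrix κ κ K} (h : Sim A B) (g : K[X]) :
    (aeval B g).rank ≤ (aeval A g).rank := by
  obtain ⟨S, S', h₁, h₂, h₃⟩ := h
  have : aeval B g = S * (aeval A g * S') := by
    rw [← Matrix.mul_assoc, mul_aeval_of_mul_eq h₃, Matrix.mul_assoc, h₁, Matrix.mul_one]
  rw [this]
  exact (rank_mul_le_right _ _).trans (rank_mul_le_left _ _)

theorem Sim.rank_aeval {A : Matrix ι ι K} {B : Matrix κ κ K} (h : Sim A B) (g : K[X]) :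
    (aeval A g).rank = (aeval B g).rank :=
  le_antisymm (h.symm.rank_aeval_le g) (h.rank_aeval_le g)

theorem aeval_blockDiagonal (A : Matrix ι ι K) (g : K[X]) :
    aeval (blockDiagonal fun _ : o => A) g = blockDiagonal fun _ : o => aeval A g := by
  induction g using Polynomial.induction_on' with
  | add p q hp hq => rw [map_add, hp, hq, ← blockDiagonal_add]; simp [Pi.add_def]
  | monomial n c =>
    simp only [aeval_monomial, ← Algebra.smul_def]
    rw [← blockDiagonal_pow, ← blockDiagonal_smul]
    rfl

theorem rank_blockDiagonal_const (A : Matrix ι ι K) :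
    (blockDiagonal fun _ : o => A).rank = Fintype.card o * A.rank := by
  let e : (o → LinearMap.range A.mulVecLin) →ₗ[K] (ι × o → K) :=
    { toFun := fun v p => (v p.2).1 p.1
      map_add' := fun _ _ => rfl
      map_smul' := fun _ _ => rfl }
  have he : Function.Injective e := by
    intro v w h
    ext k i
    exact congrFun h (i, k)
  have hmul : ∀ (v : ι × o → K) (p : ι × o),
      (Matrix.blockDiagonal fun _ : o => A).mulVec v p = A.mulVec (fun i => v (i, p.2)) p.1 := by
    intro v p
    simp only [Matrix.mulVec, dotProduct, Fintype.sum_prod_type, blockDiagonal_apply, ite_mul,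
      zero_mul, Finset.sum_ite_eq, Finset.mem_univ, if_true]
  have hr : LinearMap.range e = LinearMap.range (Matrix.blockDiagonal fun _ : o => A).mulVecLin := by
    ext v
    constructor
    · rintro ⟨w, rfl⟩
      choose u hu using fun k => (w k).2
      refine ⟨fun p => u p.2 p.1, ?_⟩
      ext p
      rw [Matrix.mulVecLin_apply, hmul]
      exact congrFun (hu p.2) p.1
    · rintro ⟨w, rfl⟩
      refine ⟨fun k => ⟨_, ⟨fun i => w (i, k), rfl⟩⟩, ?_⟩
      ext p
      rw [Matrix.mulVecLin_apply, hmul]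
      rfl
  rw [Matrix.rank, ← hr, LinearMap.finrank_range_of_inj he, Module.finrank_pi_fintype]
  simp [Matrix.rank]

theorem rank_aeval_blockDiagonal (A : Matrix ι ι K) (g : K[X]) :
    (aeval (blockDiagonal fun _ : o => A) g).rank = Fintype.card o * (aeval A g).rank := by
  rw [aeval_blockDiagonal, rank_blockDiagonal_const]

/-- Project the range of the block matrix to the lower coordinates: the image contains the range of
`D`, and the kernel contains a copy of the range of `A`. -/
theorem rank_add_rank_le_rank_fromBlocks (A : Matrix ι ι K) (B : Matrix ι κ K) (D : Matrix κ κ K) :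
    A.rank + D.rank ≤ (fromBlocks A B 0 D).rank := by
  let W := LinearMap.range (fromBlocks A B 0 D).mulVecLin
  let p : W →ₗ[K] (κ → K) := (LinearMap.funLeft K K Sum.inr) ∘ₗ W.subtype
  have hp : LinearMap.range D.mulVecLin ≤ LinearMap.range p := by
    rintro _ ⟨v, rfl⟩
    refine ⟨⟨_, ⟨Sum.elim 0 v, rfl⟩⟩, ?_⟩
    ext i
    simp [p, LinearMap.funLeft_apply, fromBlocks_mulVec]
  let j : LinearMap.range A.mulVecLin →ₗ[K] LinearMap.ker p :=
    { toFun := fun v => ⟨⟨Sum.elim v.1 0, by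
          obtain ⟨w, hw⟩ := v.2
          refine ⟨Sum.elim w 0, ?_⟩
          rw [← hw]
          ext (i | i) <;> simp [fromBlocks_mulVec]⟩, by
          ext i; simp [p, LinearMap.funLeft_apply]⟩
      map_add' := fun v w => by
        ext (i | i) <;> simp
      map_smul' := fun c v => by
        ext (i | i) <;> simp }
  have hj : Function.Injective j := by
    intro v w h
    ext i
    have := congrArg (fun x => x.1.1 (Sum.inl i)) h
    simpa [j] using this
  have h₁ := LinearMap.finrank_range_add_finrank_ker p
  have h₂ := Submodule.finrank_mono hp
  have h₃ := LinearMap.finrank_le_finrank_of_injective hj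
  simp only [Matrix.rank]
  change _ ≤ Module.finrank K W
  omega

theorem rank_aeval_fromBlocks (A : Matrix ι ι K) (B : Matrix ι κ K) (D : Matrix κ κ K) (g : K[X]) :
    (aeval A g).rank + (aeval D g).rank ≤ (aeval (fromBlocks A B 0 D) g).rank := by
  have : ∃ B' : Matrix ι κ K,
      aeval (fromBlocks A B 0 D) g = fromBlocks (aeval A g) B' 0 (aeval D g) := by
    induction g using Polynomial.induction_on' with
    | add p q hp hq =>
      obtain ⟨B₁, h₁⟩ := hp
      obtain ⟨B₂, h₂⟩ := hq
      exact ⟨B₁ + B₂, by simp [h₁, h₂, fromBlocks_add]⟩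
    | monomial n c =>
      have hn : ∃ B' : Matrix ι κ K, fromBlocks A B 0 D ^ n = fromBlocks (A ^ n) B' 0 (D ^ n) := by
        induction n with
        | zero => exact ⟨0, by simp⟩
        | succ n ih =>
          obtain ⟨B', h⟩ := ih
          exact ⟨A ^ n * B + B' * D, by rw [pow_succ, h, fromBlocks_multiply]; simp [pow_succ]⟩
      obtain ⟨B', h⟩ := hn
      exact ⟨c • B', by simp [aeval_monomial, ← Algebra.smul_def, h, fromBlocks_smul]⟩
  obtain ⟨B', h⟩ := this
  rw [h]
  exact rank_add_rank_le_rank_fromBlocks _ _ _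

end Rank

/-! ### Substituting a representation into the entries of a matrix -/

section BlockExt

variable {R T : Type*} [CommRing R] [CommRing T]
variable {ι κ τ o s t : Type*} [Fintype ι] [Fintype κ] [Fintype τ] [Fintype o] [Fintype s]
  [Fintype t]
  [DecidableEq ι] [DecidableEq κ] [DecidableEq τ] [DecidableEq o] [DecidableEq s] [DecidableEq t]

/-- Replace every entry `x` of a matrix by the block `ν x`. -/
def blockExt (ν : R →+* Matrix s s T) (A : Matrix ι κ R) : Matrix (ι × s) (κ × s) T :=
  fun p q => ν (A p.1 q.1) p.2 q.2

theorem blockExt_mul (ν : R →+* Matrix s s T) (A : Matrix ι κ R) (B : Matrix κ τ R) :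
    blockExt ν (A * B) = blockExt ν A * blockExt ν B := by
  ext ⟨i, p⟩ ⟨j, q⟩
  simp [blockExt, Matrix.mul_apply, Fintype.sum_prod_type, map_sum, Matrix.sum_apply]

theorem blockExt_one (ν : R →+* Matrix s s T) : blockExt ν (1 : Matrix ι ι R) = 1 := by
  ext ⟨i, p⟩ ⟨j, q⟩
  by_cases h : i = j
  · subst h; simp [blockExt, Matrix.one_apply]
  · simp [blockExt, h]

theorem Sim.blockExt {A : Matrix ι ι R} {B : Matrix κ κ R} (h : Sim A B)
    (ν : R →+* Matrix s s T) : Sim (blockExt ν A) (blockExt ν B) := by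
  obtain ⟨S, S', h₁, h₂, h₃⟩ := h
  exact ⟨GalBimod.blockExt ν S, GalBimod.blockExt ν S', by rw [← blockExt_mul, h₁, blockExt_one],
    by rw [← blockExt_mul, h₂, blockExt_one], by rw [← blockExt_mul, h₃, blockExt_mul]⟩

/-- `blockExt ν` as a ring homomorphism. -/
def blockExtHom (ν : R →+* Matrix s s T) : Matrix ι ι R →+* Matrix (ι × s) (ι × s) T where
  toFun := blockExt ν
  map_one' := blockExt_one ν
  map_mul' := blockExt_mul ν
  map_zero' := by ext; simp [blockExt]
  map_add' A B := by ext; simp [blockExt]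

/-- Simultaneously similar ring homomorphisms have similar block extensions. -/
theorem sim_blockExt_of_conj (f : R →+* Matrix s s T) (h : R →+* Matrix t t T)
    {S : Matrix t s T} {S' : Matrix s t T} (h₁ : S * S' = 1) (h₂ : S' * S = 1)
    (hS : ∀ b, S * f b = h b * S) (A : Matrix ι ι R) : Sim (blockExt f A) (blockExt h A) := by
  refine ⟨kroneckerMap (· * ·) 1 S, kroneckerMap (· * ·) 1 S', ?_, ?_, ?_⟩
  · rw [← Matrix.mul_kronecker_mul, h₁]; simp
  · rw [← Matrix.mul_kronecker_mul, h₂]; simp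
  · ext ⟨i, p⟩ ⟨j, q⟩
    have := congrFun (congrFun (hS (A i j)) p) q
    simp only [Matrix.mul_apply] at this
    simp only [Matrix.mul_apply, Fintype.sum_prod_type, kroneckerMap_apply, blockExt,
      Matrix.one_apply, ite_mul, one_mul, zero_mul, mul_ite, mul_zero]
    rw [Finset.sum_eq_single i, Finset.sum_eq_single j]
    · simpa using this
    · intro b _ hb; simp [hb]
    · simp
    · intro b _ hb; simp [hb.symm]
    · simp

end BlockExt

/-! ### Jacobson–Bourbaki: the scalar field and the regular representation -/

section JacobsonBourbaki

variable {L : Type*} [Field L] {ι : Type} [Fintype ι] [DecidableEq ι]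

/-- The subfield of elements which a matrix representation maps to scalar matrices. -/
def scalarField [Nonempty ι] (φ : L →+* Matrix ι ι L) : Subfield L :=
  φ.eqLocusField (Matrix.scalar ι)

theorem map_coe_scalarField_mul [Nonempty ι] (φ : L →+* Matrix ι ι L) (z : scalarField φ) (b : L) :
    φ ((z : L) * b) = (z : L) • φ b := by
  have : φ z = Matrix.scalar ι (z : L) := z.2
  rw [map_mul, this, Matrix.scalar_apply, ← Matrix.smul_eq_diagonal_mul]

theorem exists_basis_sum_of_linearIndependent {V : Type*} [AddCommGroup V] [Module L V]
    [Module.Finite L V] {n : ℕ} {v : Fin n → V} (hv : LinearIndependent L v) :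
    ∃ (q : ℕ) (B : Module.Basis (Fin n ⊕ Fin q) L V), ∀ k, B (Sum.inl k) = v k := by
  obtain ⟨C, hC⟩ := Submodule.exists_isCompl (Submodule.span L (Set.range v))
  refine ⟨_, ((Module.Basis.span hv).prod (Module.finBasis L C)).map
    (Submodule.prodEquivOfIsCompl _ _ hC), fun k => ?_⟩
  simp [Module.Basis.span_apply]

/-- The conjugacy writes each block φ(φ(x)_pq) as a fixed L-linear function of φ(x). Expanding `g`
in matrix entries therefore makes the composite of two functions b ↦ f(φ(b)), with a multiplication
by `y` in between, again a function of this kind. -/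
theorem exists_functional_comp {φ : L →+* Matrix ι ι L}
    {S S' : Matrix (ι × ι) (ι × ι) L} (h₁ : S * S' = 1)
    (hS : ∀ b, S * blockDiagonal (fun _ : ι => φ b) = blockExt φ (φ b) * S)
    (f g : Matrix ι ι L →ₗ[L] L) (y : L) :
    ∃ h : Matrix ι ι L →ₗ[L] L, ∀ x, f (φ (y * g (φ x))) = h (φ x) := by
  have key : ∀ x, blockExt φ (φ x) = S * blockDiagonal (fun _ : ι => φ x) * S' := fun x => by
    rw [hS, Matrix.mul_assoc, h₁, Matrix.mul_one]
  let Ψ (p q : ι) : Matrix ι ι L →ₗ[L] Matrix ι ι L :=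
    { toFun := fun M i l => (S * blockDiagonal (fun _ : ι => M) * S') (p, i) (q, l)
      map_add' := fun M N => by
        have : (blockDiagonal fun _ : ι => M + N) =
            blockDiagonal (fun _ : ι => M) + blockDiagonal (fun _ : ι => N) :=
          blockDiagonal_add (fun _ : ι => M) (fun _ : ι => N)
        ext i l
        rw [this, Matrix.mul_add, Matrix.add_mul]
        rfl
      map_smul' := fun c M => by
        have : (blockDiagonal fun _ : ι => c • M) = c • blockDiagonal (fun _ : ι => M) :=
          blockDiagonal_smul c (fun _ : ι => M)
        ext i l
        rw [this, Matrix.mul_smul, Matrix.smul_mul]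
        rfl }
  have hΨ : ∀ x p q, Ψ p q (φ x) = φ (φ x p q) := fun x p q => by
    ext i l
    change (S * blockDiagonal (fun _ : ι => φ x) * S') (p, i) (q, l) = _
    rw [← key]
    rfl
  have hg : ∀ M : Matrix ι ι L, g M = ∑ p, ∑ q, g (single p q 1) * M p q := fun M => by
    conv_lhs => rw [matrix_eq_sum_single M]
    simp only [map_sum]
    refine Finset.sum_congr rfl fun p _ => Finset.sum_congr rfl fun q _ => ?_
    rw [mul_comm, ← smul_eq_mul, ← map_smul, smul_single, smul_eq_mul, mul_one]
  refine ⟨f ∘ₗ ∑ p, ∑ q, LinearMap.mulLeft L (φ (y * g (single p q 1))) ∘ₗ Ψ p q, fun x => ?_⟩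
  rw [hg (φ x), Finset.mul_sum]
  simp only [Finset.mul_sum, map_sum, LinearMap.comp_apply, LinearMap.sum_apply,
    LinearMap.mulLeft_apply, hΨ, ← map_mul, mul_assoc]

/-- A representation by matrices whose entries span a space of maps closed under composition has
finite degree over its scalar field, and its values on a basis are linearly independent. -/
theorem exists_basis_scalarField [Nonempty ι] {φ : L →+* Matrix ι ι L}
    {S S' : Matrix (ι × ι) (ι × ι) L} (h₁ : S * S' = 1)
    (hS : ∀ b, S * blockDiagonal (fun _ : ι => φ b) = blockExt φ (φ b) * S) :
    ∃ (n q : ℕ) (x : Module.Basis (Fin n) (scalarField φ) L)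
      (B : Module.Basis (Fin n ⊕ Fin q) L (Matrix ι ι L)), ∀ k, B (Sum.inl k) = φ (x k) := by
  obtain ⟨κ, u, -, hspan, hli⟩ := exists_linearIndependent' L (φ : L → Matrix ι ι L)
  have := hli.finite
  obtain ⟨n, ⟨e⟩⟩ := Finite.exists_equiv_fin κ
  obtain ⟨x, hx⟩ : ∃ x : Fin n → L, x = u ∘ e.symm := ⟨_, rfl⟩
  have hli' : LinearIndependent L (φ ∘ x) := by
    rw [hx, ← Function.comp_assoc]
    exact hli.comp _ e.symm.injective
  have hspan' : ∀ b, φ b ∈ Submodule.span L (Set.range (φ ∘ x)) := fun b => by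
    rw [hx, ← Function.comp_assoc, Set.range_comp (_ ∘ u), e.symm.surjective.range_eq,
      Set.image_univ, hspan]
    exact Submodule.subset_span ⟨b, rfl⟩
  obtain ⟨q, B, hB⟩ := exists_basis_sum_of_linearIndependent hli'
  have hcoord : ∀ i j, B.coord (Sum.inl i) (φ (x j)) = if i = j then 1 else 0 := fun i j => by
    have := hB j
    rw [Function.comp_apply] at this
    rw [← this, Module.Basis.coord_apply, B.repr_self, Finsupp.single_apply]
    simp [eq_comm]
  let D (k : Fin n) (b : L) : L := B.coord (Sum.inl k) (φ b)
  have hrep : ∀ b, φ b = ∑ k, D k b • φ (x k) := fun b => by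
    obtain ⟨c, hc⟩ := (Submodule.mem_span_range_iff_exists_fun L).1 (hspan' b)
    have : ∀ k, D k b = c k := fun k => by
      simp only [D]
      rw [← hc]
      simp [hcoord]
    simp only [this]
    exact hc.symm
  -- The functional `h` representing the left side is determined on the span of the φ(x_j) by its
  -- values there, where D_k(x_j) is 0 or 1.
  have hD : ∀ i k y b, D i (y * D k b) = D i y * D k b := fun i k y b => by
    obtain ⟨h, hh⟩ := exists_functional_comp h₁ hS (B.coord (Sum.inl i)) (B.coord (Sum.inl k)) y
    have hj : ∀ j, h (φ (x j)) = if k = j then D i y else 0 := fun j => by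
      rw [← hh, hcoord]
      split_ifs <;> simp [D]
    calc D i (y * D k b) = h (φ b) := hh b
      _ = D i y * D k b := by
        rw [hrep b, map_sum]
        simp [hj, mul_comm]
  -- With y = 1 the previous identity shows that φ(D_k b) has the coordinates of D_k b · φ(1), a
  -- scalar matrix.
  have hZ : ∀ k b, D k b ∈ scalarField φ := fun k b => by
    change φ (D k b) = Matrix.scalar ι (D k b)
    have h1 : ∀ i, D i (D k b) = D k b * D i 1 := fun i => by
      rw [mul_comm, ← hD, one_mul]
    rw [hrep (D k b)]
    rw [Finset.sum_congr rfl (fun i _ => by rw [h1, mul_smul] :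
      ∀ i ∈ Finset.univ, D i (D k b) • φ (x i) = D k b • D i 1 • φ (x i)), ← Finset.smul_sum,
      ← hrep, map_one]
    ext i j
    simp [Matrix.one_apply, Matrix.diagonal_apply]
  have hsum : ∀ b, ∑ k, (⟨D k b, hZ k b⟩ : scalarField φ) • x k = b := fun b => by
    apply φ.injective
    rw [map_sum, hrep b]
    exact Finset.sum_congr rfl fun k _ => map_coe_scalarField_mul φ ⟨D k b, hZ k b⟩ (x k)
  have hxli : LinearIndependent (scalarField φ) x := by
    rw [Fintype.linearIndependent_iff] at hli' ⊢
    intro c hc k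
    refine Subtype.ext (hli' (fun k => (c k : L)) ?_ k)
    rw [← map_zero φ, ← hc, map_sum]
    exact Finset.sum_congr rfl fun k _ => (map_coe_scalarField_mul φ (c k) (x k)).symm
  refine ⟨n, q, Module.Basis.mk hxli fun b _ => ?_, B, fun k => by
    rw [hB, Module.Basis.mk_apply]; rfl⟩
  rw [Submodule.mem_span_range_iff_exists_fun]
  exact ⟨_, hsum b⟩

/-- Left multiplication by `φ b` on matrices is both a sum of copies of `φ b` and an extension of
a representation `κ` by the regular representation over the scalar field. -/
theorem exists_conj_fromBlocks [Nonempty ι] {φ : L →+* Matrix ι ι L} {n q : ℕ}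
    (x : Module.Basis (Fin n) (scalarField φ) L)
    (B : Module.Basis (Fin n ⊕ Fin q) L (Matrix ι ι L)) (hB : ∀ k, B (Sum.inl k) = φ (x k)) :
    ∃ (M : L →+* Matrix (Fin n ⊕ Fin q) (Fin n ⊕ Fin q) L) (κ : L →+* Matrix (Fin q) (Fin q) L)
      (β : L → Matrix (Fin n) (Fin q) L) (T : Matrix (Fin n ⊕ Fin q) (ι × ι) L)
      (T' : Matrix (ι × ι) (Fin n ⊕ Fin q) L),
      T * T' = 1 ∧ T' * T = 1 ∧ (∀ b, T * blockDiagonal (fun _ : ι => φ b) = M b * T) ∧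
      ∀ b, M b = fromBlocks ((Algebra.leftMulMatrix x b).map (algebraMap (scalarField φ) L))
        (β b) 0 (κ b) := by
  let M : L →+* Matrix (Fin n ⊕ Fin q) (Fin n ⊕ Fin q) L :=
    ((LinearMap.toMatrixAlgEquiv B).toRingEquiv.toRingHom.comp
      (Algebra.lmul L (Matrix ι ι L)).toRingHom).comp φ
  have hM : ∀ b, M b = LinearMap.toMatrix B B (LinearMap.mulLeft L (φ b)) := fun b => rfl
  -- The span of the φ(x_k) is stable, since φ(b)φ(x_k) = φ(b x_k) and φ is linear over the scalar
  -- field; this is the regular representation.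
  have hmul : ∀ b k, φ b * φ (x k) =
      ∑ j, (algebraMap (scalarField φ) L (Algebra.leftMulMatrix x b j k)) • φ (x j) := fun b k => by
    rw [← map_mul, ← x.sum_repr (b * x k), map_sum]
    refine Finset.sum_congr rfl fun j _ => ?_
    rw [Algebra.leftMulMatrix_eq_repr_mul]
    exact map_coe_scalarField_mul φ _ _
  have hinl : ∀ b j k, M b j (Sum.inl k) = Sum.elim
      (fun j => algebraMap (scalarField φ) L (Algebra.leftMulMatrix x b j k)) 0 j := fun b j k => by
    rw [hM, LinearMap.toMatrix_apply, hB, LinearMap.mulLeft_apply, hmul]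
    simp only [← hB, map_sum, map_smul, B.repr_self]
    rw [Finsupp.finsetSum_apply]
    rcases j with j | j
    · simp [Finsupp.single_apply, Algebra.smul_def]
    · simp
  have h21 : ∀ b, (M b).toBlocks₂₁ = 0 := fun b => by
    ext i j
    exact hinl b _ _
  have hblocks : ∀ b, M b = fromBlocks (M b).toBlocks₁₁ (M b).toBlocks₁₂ 0 (M b).toBlocks₂₂ :=
    fun b => by rw [← h21 b, fromBlocks_toBlocks]
  let κ : L →+* Matrix (Fin q) (Fin q) L :=
    { toFun := fun b => (M b).toBlocks₂₂
      map_one' := by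
        rw [map_one, ← fromBlocks_one, toBlocks_fromBlocks₂₂]
      map_mul' := fun b c => by
        rw [map_mul, hblocks b, hblocks c, fromBlocks_multiply]
        simp
      map_zero' := by rw [map_zero]; rfl
      map_add' := fun b c => by rw [map_add]; rfl }
  refine ⟨M, κ, fun b => (M b).toBlocks₁₂, B.toMatrix (Matrix.stdBasis L ι ι),
    (Matrix.stdBasis L ι ι).toMatrix B, B.toMatrix_mul_toMatrix_flip _,
    (Matrix.stdBasis L ι ι).toMatrix_mul_toMatrix_flip _, fun b => ?_, fun b => ?_⟩
  -- Left multiplication acts on each column separately, so every column contributes one copy of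
  -- φ(b).
  · have : blockDiagonal (fun _ : ι => φ b) = LinearMap.toMatrix (Matrix.stdBasis L ι ι)
        (Matrix.stdBasis L ι ι) (LinearMap.mulLeft L (φ b)) := by
      ext ⟨i, j⟩ ⟨k, l⟩
      rw [LinearMap.toMatrix_apply, Matrix.stdBasis_eq_single, LinearMap.mulLeft_apply,
        blockDiagonal_apply]
      have : φ b * single k l 1 = ∑ i, φ b i k • single i l 1 := by
        ext p r
        simp [Matrix.sum_apply, Matrix.mul_apply, single_apply, ite_and]
      rw [this]
      simp only [map_sum, map_smul, ← Matrix.stdBasis_eq_single, Module.Basis.repr_self]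
      rw [Finsupp.finsetSum_apply]
      simp [Finsupp.single_apply, ite_and, eq_comm]
    rw [this, hM, basis_toMatrix_mul_linearMap_toMatrix, linearMap_toMatrix_mul_basis_toMatrix]
  · conv_lhs => rw [hblocks b]
    congr 1
    ext i j
    exact hinl b _ _

end JacobsonBourbaki

/-! ### Companion matrices -/

section Companion

variable {F : Type*} [Field F] {ι : Type} [Fintype ι] [DecidableEq ι]

theorem Sim.map {R T : Type*} [CommRing R] [CommRing T] {κ : Type*} [Fintype κ] [DecidableEq κ]
    {A : Matrix ι ι R} {B : Matrix κ κ R} (h : Sim A B) (f : R →+* T) :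
    Sim (A.map f) (B.map f) := by
  obtain ⟨S, S', h₁, h₂, h₃⟩ := h
  refine ⟨S.map f, S'.map f, ?_, ?_, ?_⟩
  · rw [← Matrix.map_mul, h₁, Matrix.map_one _ (map_zero f) (map_one f)]
  · rw [← Matrix.map_mul, h₂, Matrix.map_one _ (map_zero f) (map_one f)]
  · rw [← Matrix.map_mul, h₃, Matrix.map_mul]

/-- The matrix of multiplication by the root on `AdjoinRoot m`. -/
noncomputable def companionMatrix {m : F[X]} (hm : m ≠ 0) :
    Matrix (Fin (AdjoinRoot.powerBasis hm).dim) (Fin (AdjoinRoot.powerBasis hm).dim) F :=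
  Algebra.leftMulMatrix (AdjoinRoot.powerBasis hm).basis (AdjoinRoot.root m)

/-- An endomorphism killed by an irreducible polynomial is a sum of copies of its companion
matrix. -/
theorem exists_sim_blockDiagonal_companionMatrix {W : Type*} [AddCommGroup W] [Module F W]
    (b : Module.Basis ι F W) (f : Module.End F W) {m : F[X]} (hm : Irreducible m)
    (hf : aeval f m = 0) :
    ∃ t, t * m.natDegree = Fintype.card ι ∧
      Sim (LinearMap.toMatrix b b f) (blockDiagonal fun _ : Fin t => companionMatrix hm.ne_zero) := by
  have : Fact (Irreducible m) := ⟨hm⟩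
  have : Module.Finite F W := Module.Finite.of_basis b
  let Φ : AdjoinRoot m →ₐ[F] Module.End F W := 
    Ideal.Quotient.liftₐ (Ideal.span {m}) (aeval f) fun p hp => by
      obtain ⟨r, rfl⟩ := Ideal.mem_span_singleton'.1 hp
      rw [map_mul, hf, mul_zero]
  -- `W` becomes a vector space over the field F[X]/(m), with `f` acting as the root; a basis there
  -- combined with the power basis gives the companion blocks.
  let _ : Module (AdjoinRoot m) W := Module.compHom W Φ.toRingHom
  have hsmul : ∀ (y : AdjoinRoot m) (w : W), y • w = Φ y w := fun _ _ => rfl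
  have : IsScalarTower F (AdjoinRoot m) W := ⟨fun c y w => by
    rw [hsmul, hsmul, map_smul, LinearMap.smul_apply]⟩
  have : Module.Finite (AdjoinRoot m) W := Module.Finite.of_restrictScalars_finite F _ W
  let c := Module.finBasis (AdjoinRoot m) W
  let pb := AdjoinRoot.powerBasis hm.ne_zero
  have hdim : pb.dim = m.natDegree := AdjoinRoot.powerBasis_dim hm.ne_zero
  refine ⟨Module.finrank (AdjoinRoot m) W, ?_, (sim_toMatrix b (pb.basis.smulTower c) f).trans ?_⟩
  · rw [← Module.finrank_eq_card_basis b, ← Module.finrank_mul_finrank F (AdjoinRoot m) W,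
      pb.finrank, hdim, mul_comm]
  · refine sim_of_equiv (Equiv.refl _) ?_
    rintro ⟨i, j⟩ ⟨k, l⟩
    have hroot : ∀ w, f w = AdjoinRoot.root m • w := fun w => by
      have : Φ (AdjoinRoot.root m) = aeval f X := rfl
      rw [hsmul, this, aeval_X]
    rw [LinearMap.toMatrix_apply, hroot, Module.Basis.smulTower_repr, Module.Basis.smulTower_apply,
      smul_smul, map_smul, c.repr_self]
    simp only [Equiv.refl_apply, blockDiagonal_apply, Finsupp.smul_apply, Finsupp.single_apply,
      companionMatrix, Algebra.leftMulMatrix_eq_repr_mul]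
    split_ifs with h1 h2 h2
    · simp [pb]
    · exact absurd h1.symm h2
    · exact absurd h2.symm h1
    · simp

end Companion

/-! ### The rank inequality -/

section Inequality

variable {L : Type*} [Field L] {ι : Type} [Fintype ι] [DecidableEq ι] [Nonempty ι]
variable {K : Type*} [Field K] [Algebra L K]

theorem blockExt_map_of_scalar {R : Type*} [CommRing R] {τ : R →+* L} {κ s : Type}
    [Fintype s] [DecidableEq s] (ν : L →+* Matrix s s K)
    (hν : ∀ z : R, ν (τ z) = Matrix.scalar s (algebraMap L K (τ z))) (X : Matrix κ κ R) :
    blockExt ν (X.map τ) = blockDiagonal fun _ : s => X.map ((algebraMap L K).comp τ) := by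
  ext ⟨i, p⟩ ⟨j, q⟩
  simp [blockExt, hν, blockDiagonal_apply, Matrix.diagonal_apply]

/-- The extended matrix is that of φ(a) acting on L^ι regarded as a space over the scalar field.
Since φ is linear over that field, this operator is killed by the minimal polynomial of `a`. -/
theorem sim_blockExt_leftMulMatrix {φ : L →+* Matrix ι ι L} {n : ℕ}
    (x : Module.Basis (Fin n) (scalarField φ) L) (a : L)
    (ha : Irreducible (minpoly (scalarField φ) a)) :
    ∃ t, t * (minpoly (scalarField φ) a).natDegree = Fintype.card ι * n ∧
      Sim (blockExt (Algebra.leftMulMatrix x).toRingHom (φ a))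
        (blockDiagonal fun _ : Fin t => companionMatrix ha.ne_zero) := by
  let b := (x.smulTower (Pi.basisFun L ι)).reindex (Equiv.prodComm _ _)
  let f : Module.End (scalarField φ) (ι → L) := (φ a).mulVecLin.restrictScalars (scalarField φ)
  have hf : ∀ g : (scalarField φ)[X], ∀ v, aeval f g v = (φ (aeval a g)).mulVec v := fun g => by
    induction g using Polynomial.induction_on' with
    | add p q hp hq =>
      intro v
      rw [map_add, map_add, map_add, LinearMap.add_apply, hp, hq, Matrix.add_mulVec]
    | monomial k c =>
      have hk : ∀ v, (f ^ k) v = (φ a ^ k).mulVec v := by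
        induction k with
        | zero => simp
        | succ k ih =>
          intro v
          rw [pow_succ, pow_succ, Module.End.mul_apply, ih, ← Matrix.mulVec_mulVec]
          rfl
      intro v
      rw [aeval_monomial, aeval_monomial, ← Algebra.smul_def, LinearMap.smul_apply, hk]
      change _ = (φ ((c : L) * a ^ k)).mulVec v
      rw [map_coe_scalarField_mul, map_pow, Matrix.smul_mulVec]
      rfl
  obtain ⟨t, ht, hs⟩ := exists_sim_blockDiagonal_companionMatrix b f ha (by
    refine LinearMap.ext fun v => ?_
    rw [hf, minpoly.aeval, map_zero, Matrix.zero_mulVec, LinearMap.zero_apply])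
  refine ⟨t, by rw [ht, Fintype.card_prod, Fintype.card_fin], ?_⟩
  convert hs using 1
  ext ⟨i, l⟩ ⟨j, k⟩
  rw [LinearMap.toMatrix_apply, Module.Basis.repr_reindex_apply, Module.Basis.smulTower_repr]
  simp [b, blockExt, f, Module.Basis.smulTower_apply, Algebra.leftMulMatrix_eq_repr_mul, mul_comm]

/-- Using the conjugacy twice, d² copies of φ(a) become d copies of φ(φ(a)), that is, the
representation b ↦ (d copies of φ(b)) substituted into φ(a). That representation is conjugate to
`M`, whose triangular shape splits off `ω` and `κ`. Substituting `ν` and taking ranks gives the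
inequality. -/
theorem rank_recursion {φ : L →+* Matrix ι ι L}
    {S S' : Matrix (ι × ι) (ι × ι) L} (h₁ : S * S' = 1) (h₂ : S' * S = 1)
    (hS : ∀ b, S * blockDiagonal (fun _ : ι => φ b) = blockExt φ (φ b) * S)
    {n q : ℕ} {M : L →+* Matrix (Fin n ⊕ Fin q) (Fin n ⊕ Fin q) L}
    {κ : L →+* Matrix (Fin q) (Fin q) L} {β : L → Matrix (Fin n) (Fin q) L}
    {T : Matrix (Fin n ⊕ Fin q) (ι × ι) L} {T' : Matrix (ι × ι) (Fin n ⊕ Fin q) L}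
    (hT : T * T' = 1) (hT' : T' * T = 1)
    (hTM : ∀ b, T * blockDiagonal (fun _ : ι => φ b) = M b * T)
    (ω : L →+* Matrix (Fin n) (Fin n) L) (hM : ∀ b, M b = fromBlocks (ω b) (β b) 0 (κ b))
    (a : L) (g : K[X]) {s : Type} [Fintype s] [DecidableEq s] (ν : L →+* Matrix s s K) :
    (aeval (blockExt ν (blockExt ω (φ a))) g).rank +
      (aeval (blockExt ((blockExtHom ν).comp κ) (φ a)) g).rank ≤
    Fintype.card ι * (Fintype.card ι * (aeval (blockExt ν (φ a)) g).rank) := by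
  let δ : L →+* Matrix (ι × ι) (ι × ι) L :=
    (blockDiagonalRingHom ι ι L).comp ((Pi.constRingHom ι _).comp φ)
  have hδ : ∀ b, δ b = blockDiagonal (fun _ : ι => φ b) := fun b => rfl
  have e₁ : Sim (blockDiagonal fun _ : ι => φ a) (blockExt φ (φ a)) := ⟨S, S', h₁, h₂, hS a⟩
  have e₂ : Sim (blockDiagonal fun _ : ι => blockExt φ (φ a)) (blockExt δ (φ a)) := by
    refine sim_of_equiv (Equiv.prodAssoc _ _ _) ?_
    rintro ⟨⟨i, p⟩, o⟩ ⟨⟨j, r⟩, o'⟩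
    simp [blockExt, hδ, blockDiagonal_apply]
  have e₃ : Sim (blockExt δ (φ a)) (blockExt M (φ a)) :=
    sim_blockExt_of_conj δ M hT hT' hTM _
  have e₄ : ∃ X, Sim (blockExt M (φ a)) (fromBlocks (blockExt ω (φ a)) X 0 (blockExt κ (φ a))) := by
    refine ⟨fun p r => β (φ a p.1 r.1) p.2 r.2, sim_of_equiv (Equiv.prodSumDistrib _ _ _) ?_⟩
    rintro ⟨i, p | p⟩ ⟨j, r | r⟩ <;>
      (simp only [blockExt, hM]; rfl)
  obtain ⟨X, e₄⟩ := e₄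
  have e₅ : ∃ Y, Sim (blockExt ν (fromBlocks (blockExt ω (φ a)) X 0 (blockExt κ (φ a))))
      (fromBlocks (blockExt ν (blockExt ω (φ a))) Y 0 (blockExt ν (blockExt κ (φ a)))) := by
    refine ⟨fun p r => ν (X p.1 r.1) p.2 r.2, sim_of_equiv (Equiv.sumProdDistrib _ _ _) ?_⟩
    rintro ⟨i | i, p⟩ ⟨j | j, r⟩
    · rfl
    · rfl
    · exact (congrFun (congrFun (map_zero ν) p) r).symm
    · rfl
  obtain ⟨Y, e₅⟩ := e₅
  have e₆ : Sim (blockExt ν (blockExt κ (φ a))) (blockExt ((blockExtHom ν).comp κ) (φ a)) := by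
    refine sim_of_equiv (Equiv.prodAssoc _ _ _) ?_
    rintro ⟨⟨i, p⟩, o⟩ ⟨⟨j, r⟩, o'⟩
    rfl
  have e₇ : Sim (blockDiagonal fun _ : ι => blockDiagonal fun _ : ι => blockExt ν (φ a))
      (blockExt ν (blockDiagonal fun _ : ι => blockDiagonal fun _ : ι => φ a)) := by
    let e : ((ι × s) × ι) × ι ≃ ((ι × ι) × ι) × s :=
      { toFun := fun p => (((p.1.1.1, p.1.2), p.2), p.1.1.2)
        invFun := fun p => (((p.1.1.1, p.2), p.1.1.2), p.1.2)
        left_inv := fun _ => rfl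
        right_inv := fun _ => rfl }
    refine sim_of_equiv e ?_
    rintro ⟨⟨⟨i, p⟩, o⟩, u⟩ ⟨⟨⟨j, r⟩, o'⟩, u'⟩
    simp only [e, Equiv.coe_fn_mk, blockExt, blockDiagonal_apply]
    split_ifs <;> simp
  have e := e₇.trans ((((e₁.blockDiagonal.trans e₂).trans (e₃.trans e₄)).blockExt ν).trans e₅)
  have h := rank_aeval_fromBlocks (blockExt ν (blockExt ω (φ a))) Y
    (blockExt ν (blockExt κ (φ a))) g
  rw [← e.rank_aeval, e₆.rank_aeval, rank_aeval_blockDiagonal, rank_aeval_blockDiagonal] at h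
  exact h

/-- Up to normalization by the degree, the rank of `g (φ a)` is at least that of `g (C)`, where `C`
is the companion matrix of the minimal polynomial of `a` over the scalar field. -/
theorem card_mul_rank_companionMatrix_le {φ : L →+* Matrix ι ι L}
    {S S' : Matrix (ι × ι) (ι × ι) L} (h₁ : S * S' = 1) (h₂ : S' * S = 1)
    (hS : ∀ b, S * blockDiagonal (fun _ : ι => φ b) = blockExt φ (φ b) * S) (a : L)
    (ha : Irreducible (minpoly (scalarField φ) a)) (g : K[X]) :
    Fintype.card ι * (aeval ((companionMatrix ha.ne_zero).map
      ((algebraMap L K).comp (algebraMap (scalarField φ) L))) g).rank ≤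
    (minpoly (scalarField φ) a).natDegree * (aeval ((φ a).map (algebraMap L K)) g).rank := by
  obtain ⟨n, q, x, B, hB⟩ := exists_basis_scalarField h₁ hS
  obtain ⟨M, κ, β, T, T', hT, hT', hTM, hM⟩ := exists_conj_fromBlocks x B hB
  obtain ⟨t, ht, hsim⟩ := sim_blockExt_leftMulMatrix x a ha
  have hnq : n + q = Fintype.card ι * Fintype.card ι := by
    have := Module.finrank_eq_card_basis B
    rw [Module.finrank_matrix] at this
    simpa using this.symm
  have hn : 0 < n := by
    have := x.index_nonempty
    exact Fin.pos_iff_nonempty.2 this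
  set c := (aeval ((companionMatrix ha.ne_zero).map
      ((algebraMap L K).comp (algebraMap (scalarField φ) L))) g).rank with hc
  set k := (minpoly (scalarField φ) a).natDegree with hk
  set d := Fintype.card ι with hd
  have hd0 : 0 < d := Fintype.card_pos
  -- Linearity over the scalar field turns the substitution of `ν` into a matrix over that field
  -- into a sum of copies, and it passes from `ν` to the composite of `ν` with `κ`.
  let Lin {s : Type} [Fintype s] [DecidableEq s] (ν : L →+* Matrix s s K) : Prop :=
    ∀ z : scalarField φ, ν z = Matrix.scalar s (algebraMap L K z)
  have hrec : ∀ {s : Type} [Fintype s] [DecidableEq s] (ν : L →+* Matrix s s K), Lin ν →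
      Fintype.card s * (t * c) + (aeval (blockExt ((blockExtHom ν).comp κ) (φ a)) g).rank ≤
        d * (d * (aeval (blockExt ν (φ a)) g).rank) := by
    intro s _ _ ν hν
    refine le_trans (le_of_eq ?_) (rank_recursion h₁ h₂ hS hT hT' hTM
      ((algebraMap (scalarField φ) L).mapMatrix.comp (Algebra.leftMulMatrix x).toRingHom) hM a g ν)
    congr 1
    have : blockExt ((algebraMap (scalarField φ) L).mapMatrix.comp
        (Algebra.leftMulMatrix x).toRingHom) (φ a) =
        (blockExt (Algebra.leftMulMatrix x).toRingHom (φ a)).map (algebraMap (scalarField φ) L) :=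
      rfl
    rw [this, blockExt_map_of_scalar ν hν, rank_aeval_blockDiagonal,
      (hsim.map ((algebraMap L K).comp (algebraMap (scalarField φ) L))).rank_aeval,
      blockDiagonal_map _ _ (map_zero _), rank_aeval_blockDiagonal, Fintype.card_fin]
  have hκ : ∀ z : scalarField φ, κ z = Matrix.scalar (Fin q) (z : L) := fun z => by
    have hz : φ z = (z : L) • (1 : Matrix ι ι L) := by
      rw [← mul_one (z : L), map_coe_scalarField_mul, map_one, mul_one]
    have h : M z = (z : L) • 1 := by
      calc M z = M z * T * T' := by rw [Matrix.mul_assoc, hT, Matrix.mul_one]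
        _ = T * ((z : L) • blockDiagonal (1 : ι → Matrix ι ι L)) * T' := by
          rw [← hTM, hz, ← blockDiagonal_smul]; rfl
        _ = (z : L) • 1 := by
          rw [blockDiagonal_one, Matrix.mul_smul, Matrix.smul_mul, Matrix.mul_one, hT]
    have h' := congrArg Matrix.toBlocks₂₂ ((hM z).symm.trans h)
    rw [toBlocks_fromBlocks₂₂] at h'
    rw [h']
    ext i j
    simp [toBlocks₂₂, Matrix.one_apply, Matrix.diagonal_apply]
  have hLin : ∀ {s : Type} [Fintype s] [DecidableEq s] (ν : L →+* Matrix s s K), Lin ν →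
      Lin ((blockExtHom ν).comp κ : L →+* Matrix (Fin q × s) (Fin q × s) K) := by
    intro s _ _ ν hν z
    ext ⟨i, p⟩ ⟨j, r⟩
    by_cases h : i = j
    · subst h
      simp [blockExtHom, blockExt, hκ, hν z, Matrix.diagonal_apply]
    · simp [blockExtHom, blockExt, hκ, h]
  -- The recursion trades `ν` for its composite with `κ`, of size q times larger. The infimum of
  -- rank divided by size, over all admissible `ν`, bounds both sides at once.
  let U : Set ℝ := {y | ∃ (s : Type) (_ : Fintype s) (_ : DecidableEq s) (_ : Nonempty s)
    (ν : L →+* Matrix s s K), Lin ν ∧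
      y = ((aeval (blockExt ν (φ a)) g).rank : ℝ) / Fintype.card s}
  have hU : BddBelow U := ⟨0, by rintro _ ⟨s, _, _, _, ν, -, rfl⟩; positivity⟩
  let ν₀ : L →+* Matrix Unit Unit K := (Matrix.scalar Unit).comp (algebraMap L K)
  have hν₀ : ((aeval ((φ a).map (algebraMap L K)) g).rank : ℝ) ∈ U := by
    refine ⟨Unit, inferInstance, inferInstance, inferInstance, ν₀, fun z => rfl, ?_⟩
    have : Sim ((φ a).map (algebraMap L K)) (blockExt ν₀ (φ a)) := by
      refine sim_of_equiv (Equiv.prodPUnit ι).symm fun i j => ?_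
      simp [blockExt, ν₀]
    rw [this.rank_aeval]
    simp
  set I := sInf U with hI
  have hle : ∀ {s : Type} [Fintype s] [DecidableEq s] (ν : L →+* Matrix s s K), Lin ν →
      I * Fintype.card s ≤ (aeval (blockExt ν (φ a)) g).rank := by
    intro s _ _ ν hν
    -- Size zero does occur: the composite with `κ` is empty when q = 0.
    rcases isEmpty_or_nonempty s with h | h
    · simp
    · rw [← le_div_iff₀ (by exact_mod_cast Fintype.card_pos)]
      exact csInf_le hU ⟨s, _, _, h, ν, hν, rfl⟩
  have hstep : ((t * c : ℝ) + I * q) / (d * d) ≤ I := by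
    refine le_csInf ⟨_, hν₀⟩ ?_
    rintro _ ⟨s, _, _, hs, ν, hν, rfl⟩
    have h1 : ((Fintype.card s * (t * c) + (aeval (blockExt ((blockExtHom ν).comp κ) (φ a)) g).rank
        : ℕ) : ℝ) ≤ ((d * (d * (aeval (blockExt ν (φ a)) g).rank) : ℕ) : ℝ) :=
      Nat.cast_le.2 (hrec ν hν)
    have h2 := hle _ (hLin ν hν)
    have hs' : (0 : ℝ) < Fintype.card s := by exact_mod_cast Fintype.card_pos
    rw [Fintype.card_prod, Fintype.card_fin] at h2
    push_cast at h1 h2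
    rw [div_le_div_iff₀ (by positivity) hs']
    nlinarith
  -- From tc + Iq ≤ Id² and d² = n + q follows tc ≤ In; then tk = dn eliminates t.
  have hnq' : (n : ℝ) + q = d * d := by exact_mod_cast hnq
  rw [div_le_iff₀ (by positivity), ← hnq'] at hstep
  have hfin : (t * c : ℝ) ≤ I * n := by linarith
  have hI' : I ≤ ((aeval ((φ a).map (algebraMap L K)) g).rank : ℝ) := csInf_le hU hν₀
  have ht' : (t : ℝ) * k = d * n := by exact_mod_cast ht
  have hn' : (0 : ℝ) < n := by exact_mod_cast hn
  have : (d * c : ℝ) * n ≤ (k * (aeval ((φ a).map (algebraMap L K)) g).rank) * n := by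
    calc (d * c : ℝ) * n = (t * c) * k := by rw [mul_right_comm, ← ht']; ring
      _ ≤ I * n * k := by gcongr
      _ ≤ (aeval ((φ a).map (algebraMap L K)) g).rank * n * k := by gcongr
      _ = _ := by ring
  exact_mod_cast le_of_mul_le_mul_right this hn'

end Inequality

/-! ### From ranks to the characteristic polynomial -/

section Endgame

variable {K : Type*} [Field K]

/-- The vectors g(C)p(C)v with deg p < h form an h-dimensional space inside the range of g(C),
because gp has degree below k and so cannot kill v unless p = 0. -/
theorem le_rank_aeval_of_cyclic {κ : Type*} [Fintype κ] [DecidableEq κ] {C : Matrix κ κ K} {k : ℕ}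
    (v : κ → K) (hv : ∀ p : K[X], p ∈ degreeLT K k → (aeval C p).mulVec v = 0 → p = 0)
    {g : K[X]} (hg : g ≠ 0) {h : ℕ} (hk : g.natDegree + h ≤ k) : h ≤ (aeval C g).rank := by
  let e : degreeLT K h →ₗ[K] LinearMap.range (aeval C g).mulVecLin :=
    { toFun := fun p => ⟨(aeval C g).mulVec ((aeval C (p : K[X])).mulVec v), ⟨_, rfl⟩⟩
      map_add' := fun p r => Subtype.ext (by
        simp [Matrix.add_mulVec, Matrix.mulVec_add])
      map_smul' := fun c p => Subtype.ext (by
        simp [Matrix.smul_mulVec, Matrix.mulVec_smul]) }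
  have he : Function.Injective e := by
    rw [← LinearMap.ker_eq_bot, LinearMap.ker_eq_bot']
    intro p hp
    have h1 : (aeval C g).mulVec ((aeval C (p : K[X])).mulVec v) = 0 := congrArg Subtype.val hp
    rw [Matrix.mulVec_mulVec, ← map_mul] at h1
    by_contra hp0
    have hp0' : (p : K[X]) ≠ 0 := fun h => hp0 (Subtype.ext h)
    have hlt : (p : K[X]).natDegree < h :=
      (natDegree_lt_iff_degree_lt hp0').2 (mem_degreeLT.1 p.2)
    have h2 := hv _ (mem_degreeLT.2 ((natDegree_lt_iff_degree_lt (mul_ne_zero hg hp0')).1 (by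
      rw [natDegree_mul hg hp0']; omega))) h1
    exact mul_ne_zero hg hp0' h2
  have := LinearMap.finrank_le_finrank_of_injective he
  rwa [(degreeLTEquiv K h).finrank_eq, Module.finrank_fin_fun] at this

/-- The powers of the root are the power basis itself, so the vector of 1 is cyclic for the
companion matrix. -/
theorem companionMatrix_pow_mulVec {F : Type*} [Field F] {m : F[X]} (hm : m ≠ 0)
    (i j : Fin (AdjoinRoot.powerBasis hm).dim) (h0 : 0 < (AdjoinRoot.powerBasis hm).dim) :
    (companionMatrix hm ^ (i : ℕ)) j ⟨0, h0⟩ = if i = j then 1 else 0 := by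
  rw [companionMatrix, ← map_pow, Algebra.leftMulMatrix_eq_repr_mul, PowerBasis.basis_eq_pow,
    pow_zero, mul_one, ← AdjoinRoot.powerBasis_gen hm, ← PowerBasis.basis_eq_pow,
    Module.Basis.repr_self, Finsupp.single_apply]

theorem le_rank_aeval_companionMatrix {F : Type*} [Field F] {m : F[X]} (hm : m ≠ 0) (τ : F →+* K)
    {g : K[X]} (hg : g ≠ 0) {h : ℕ} (hk : g.natDegree + h ≤ m.natDegree) :
    h ≤ (aeval ((companionMatrix hm).map τ) g).rank := by
  rcases Nat.eq_zero_or_pos h with rfl | hpos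
  · exact Nat.zero_le _
  have hdim : (AdjoinRoot.powerBasis hm).dim = m.natDegree := AdjoinRoot.powerBasis_dim hm
  have h0 : 0 < (AdjoinRoot.powerBasis hm).dim := by omega
  refine le_rank_aeval_of_cyclic (k := m.natDegree) (Pi.single ⟨0, h0⟩ 1) (fun p hp hp0 => ?_) hg hk
  rw [mem_degreeLT, ← hdim] at hp
  have hpow : ∀ i j : Fin (AdjoinRoot.powerBasis hm).dim,
      ((companionMatrix hm).map τ ^ (i : ℕ)) j ⟨0, h0⟩ = if i = j then 1 else 0 := fun i j => by
    have : (companionMatrix hm).map τ ^ (i : ℕ) = (companionMatrix hm ^ (i : ℕ)).map τ :=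
      (map_pow τ.mapMatrix _ _).symm
    rw [this, Matrix.map_apply, companionMatrix_pow_mulVec]
    split_ifs <;> simp
  ext i
  rw [coeff_zero]
  by_cases hi : i < (AdjoinRoot.powerBasis hm).dim
  · have h1 := congrFun hp0 ⟨i, hi⟩
    rw [aeval_eq_sum_range' (n := (AdjoinRoot.powerBasis hm).dim) (by
      rcases eq_or_ne p 0 with rfl | hp'
      · simpa using h0
      · exact (natDegree_lt_iff_degree_lt hp').2 hp), Finset.sum_range] at h1
    rw [Matrix.mulVec_single_one] at h1
    simp only [Matrix.col_apply, Matrix.sum_apply, Matrix.smul_apply, hpow] at h1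
    simpa using h1
  · exact coeff_eq_zero_of_degree_lt (lt_of_lt_of_le hp (by exact_mod_cast not_lt.1 hi))

/-- When h(α) ≠ 0 this rank counts the Jordan blocks at α of size e + 1. In general, T - α maps the
range W_i of ((X - α)^i h)(T) onto W_(i+1), and its kernel on W_i contains W_e for i ≤ e. Each step
thus loses at least dim W_e, so dim W_0 ≥ (e + 1) dim W_e, and W_0 lies in the generalized
eigenspace of α. -/
theorem mul_rank_le_rootMultiplicity {ι : Type*} [Fintype ι] [DecidableEq ι] (T : Matrix ι ι K)
    (α : K) (h : K[X]) (e : ℕ) (hT : aeval T ((X - C α) ^ (e + 1) * h) = 0) :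
    (e + 1) * (aeval T ((X - C α) ^ e * h)).rank ≤ T.charpoly.rootMultiplicity α := by
  let f := Matrix.toLinAlgEquiv' T
  have hf : ∀ g : K[X], (aeval T g).mulVecLin = aeval f g := fun g => by
    change Matrix.toLinAlgEquiv' (aeval T g) = _
    rw [← aeval_algHom_apply]
  let W (i : ℕ) : Submodule K (ι → K) := LinearMap.range (aeval f ((X - C α) ^ i * h))
  have hW : (aeval T ((X - C α) ^ e * h)).rank = Module.finrank K (W e) := by
    rw [Matrix.rank, hf]
  have hN : aeval f (X - C α) = f - α • 1 := by
    simp [Algebra.algebraMap_eq_smul_one]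
  have hsucc : ∀ i v, (f - α • 1) (aeval f ((X - C α) ^ i * h) v) =
      aeval f ((X - C α) ^ (i + 1) * h) v := fun i v => by
    rw [← hN, ← Module.End.mul_apply, ← map_mul, pow_succ', mul_assoc]
  have hkill : aeval f ((X - C α) ^ (e + 1) * h) = 0 := by
    rw [← hf, hT, Matrix.mulVecLin_zero]
  have hmono : ∀ i j, W (i + j) ≤ W i := fun i j => by
    rintro _ ⟨v, rfl⟩
    refine ⟨aeval f ((X - C α) ^ j) v, ?_⟩
    rw [← Module.End.mul_apply, ← map_mul]
    congr 2
    ring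
  have hstep : ∀ i ≤ e, Module.finrank K (W (i + 1)) + Module.finrank K (W e) ≤
      Module.finrank K (W i) := fun i hi => by
    let p : W i →ₗ[K] (ι → K) := (f - α • 1) ∘ₗ (W i).subtype
    rw [← LinearMap.finrank_range_add_finrank_ker p]
    refine add_le_add (Submodule.finrank_mono ?_) ?_
    · rintro _ ⟨v, rfl⟩
      exact ⟨⟨_, ⟨v, rfl⟩⟩, hsucc i v⟩
    · have hle : W e ≤ W i := by
        obtain ⟨j, rfl⟩ := Nat.exists_eq_add_of_le hi
        exact hmono i j
      let q : W e →ₗ[K] LinearMap.ker p := LinearMap.codRestrict _ (Submodule.inclusion hle) (by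
        rintro ⟨_, v, rfl⟩
        change (f - α • 1) _ = 0
        exact (hsucc e v).trans (by rw [hkill]; rfl))
      refine LinearMap.finrank_le_finrank_of_injective (f := q) fun a b hab => ?_
      exact Subtype.ext (congrArg (fun x => x.1.1) hab)
  have hchain : ∀ j ≤ e + 1, j * Module.finrank K (W e) ≤ Module.finrank K (W (e + 1 - j)) := by
    intro j
    induction j with
    | zero => simp
    | succ j ih =>
      intro hj
      have h1 := ih (by omega)
      have h2 := hstep (e + 1 - (j + 1)) (by omega)
      rw [show e + 1 - (j + 1) + 1 = e + 1 - j by omega] at h2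
      linarith [add_mul j 1 (Module.finrank K (W e))]
  rw [hW, ← Matrix.charpoly_toLin', ← LinearMap.finrank_maxGenEigenspace_eq]
  refine (hchain (e + 1) le_rfl).trans (Submodule.finrank_mono ?_)
  rintro _ ⟨v, rfl⟩
  rw [Module.End.mem_maxGenEigenspace]
  refine ⟨e + 1, ?_⟩
  change ((f - α • 1) ^ (e + 1)) _ = 0
  rw [← hN, ← map_pow, ← Module.End.mul_apply, ← map_mul, Nat.sub_self, pow_zero, one_mul, hkill]
  rfl

/-- With r the least integer such that card ι ≤ r deg m, the rank bound for m/(X - α) gives rank at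
least r, so α has multiplicity in the characteristic polynomial at least r times that in m. Then m^r
divides it, and the choice of r makes its degree no larger than that of m^r. -/
theorem charpoly_eq_pow_of_rank_le [IsAlgClosed K] {ι : Type*} [Fintype ι] [DecidableEq ι]
    [Nonempty ι] (T : Matrix ι ι K) {m : K[X]} (hm : m.Monic) (hk : 0 < m.natDegree)
    (hT : aeval T m = 0)
    (hrank : ∀ g h : K[X], m = g * h →
      Fintype.card ι * h.natDegree ≤ m.natDegree * (aeval T g).rank) :
    ∃ r, 1 ≤ r ∧ T.charpoly = m ^ r := by
  have hex : ∃ r, Fintype.card ι ≤ m.natDegree * r := ⟨_, Nat.le_mul_of_pos_left _ hk⟩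
  obtain ⟨r, hr, hmin⟩ : ∃ r, Fintype.card ι ≤ m.natDegree * r ∧
      ∀ n, Fintype.card ι ≤ m.natDegree * n → r ≤ n := by
    classical
    exact ⟨Nat.find hex, Nat.find_spec hex, fun n hn => Nat.find_min' hex hn⟩
  have hmul : ∀ α, r * m.rootMultiplicity α ≤ T.charpoly.rootMultiplicity α := fun α => by
    obtain ⟨h, hh, -⟩ := exists_eq_pow_rootMultiplicity_mul_and_not_dvd m hm.ne_zero α
    rcases he : m.rootMultiplicity α with _ | e
    · simp
    rw [he] at hh
    have h1 := hrank ((X - C α) ^ e * h) (X - C α) (by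
      conv_lhs => rw [hh]
      ring)
    rw [natDegree_X_sub_C, mul_one] at h1
    rw [mul_comm]
    exact (Nat.mul_le_mul_left _ (hmin _ h1)).trans
      (mul_rank_le_rootMultiplicity T α h e (by rw [← hh, hT]))
  have hdvd : m ^ r ∣ T.charpoly := by
    classical
    rw [IsAlgClosed.dvd_iff_roots_le_roots (hm.pow r).ne_zero T.charpoly_monic.ne_zero,
      Multiset.le_iff_count]
    intro α
    rw [roots_pow, Multiset.count_nsmul, count_roots, count_roots]
    exact hmul α
  refine ⟨r, Nat.one_le_iff_ne_zero.2 ?_, eq_of_monic_of_dvd_of_natDegree_le (hm.pow r)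
    T.charpoly_monic hdvd ?_⟩
  · rintro rfl
    have : 0 < Fintype.card ι := Fintype.card_pos
    omega
  · rw [Matrix.charpoly_natDegree_eq_dim, hm.natDegree_pow, mul_comm]
    exact hr

/-- The characteristic polynomial of `φ a` is a power of its minimal polynomial, which is the
minimal polynomial of `a` over the scalar field. -/
theorem charpoly_eq_minpoly_pow {L : Type*} [Field L] {ι : Type} [Fintype ι] [DecidableEq ι]
    [Nonempty ι] {φ : L →+* Matrix ι ι L}
    {S S' : Matrix (ι × ι) (ι × ι) L} (h₁ : S * S' = 1) (h₂ : S' * S = 1)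
    (hS : ∀ b, S * blockDiagonal (fun _ : ι => φ b) = blockExt φ (φ b) * S) (a : L) :
    minpoly L (φ a) = (minpoly (scalarField φ) a).map (algebraMap (scalarField φ) L) ∧
      ∃ r, 1 ≤ r ∧ (φ a).charpoly = minpoly L (φ a) ^ r := by
  obtain ⟨n, q, x, B, hB⟩ := exists_basis_scalarField h₁ hS
  have : Module.Finite (scalarField φ) L := Module.Finite.of_basis x
  have hint : IsIntegral (scalarField φ) a := Algebra.IsIntegral.isIntegral a
  have ha := minpoly.irreducible hint
  -- Over the closure m has linear factors, possibly repeated when `a` is inseparable over the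
  -- scalar field; the Jordan block count allows for this.
  let K := AlgebraicClosure L
  set m := (minpoly (scalarField φ) a).map (algebraMap (scalarField φ) L) with hm
  have hmonic : m.Monic := (minpoly.monic hint).map _
  have hdeg : m.natDegree = (minpoly (scalarField φ) a).natDegree := natDegree_map _
  have haeval : ∀ p : (scalarField φ)[X],
      aeval (φ a) (p.map (algebraMap (scalarField φ) L)) = φ (aeval a p) := fun p => by
    induction p using Polynomial.induction_on' with
    | add p q hp hq => simp only [Polynomial.map_add, map_add, hp, hq]
    | monomial k c =>
      rw [Polynomial.map_monomial, aeval_monomial, aeval_monomial, ← Algebra.smul_def]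
      change _ = φ ((c : L) * a ^ k)
      rw [map_coe_scalarField_mul, map_pow]
      rfl
  have hm0 : aeval (φ a) m = 0 := by rw [haeval, minpoly.aeval, map_zero]
  set T : Matrix ι ι K := (φ a).map (algebraMap L K) with hTdef
  have hTaeval : ∀ p : L[X], aeval T (p.map (algebraMap L K)) = (aeval (φ a) p).map
      (algebraMap L K) := fun p => by
    rw [aeval_map_algebraMap]
    exact aeval_algHom_apply ((Algebra.ofId L K).mapMatrix) (φ a) p
  set mK := m.map (algebraMap L K) with hmK
  have hdegK : mK.natDegree = (minpoly (scalarField φ) a).natDegree := by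
    rw [hmK, natDegree_map, hdeg]
  have hrank : ∀ g h : K[X], mK = g * h →
      Fintype.card ι * h.natDegree ≤ mK.natDegree * (aeval T g).rank := fun g h hgh => by
    have hne : g * h ≠ 0 := hgh ▸ (hmonic.map _).ne_zero
    have hg : g ≠ 0 := left_ne_zero_of_mul hne
    rw [hdegK]
    refine le_trans (Nat.mul_le_mul_left _ ?_)
      (card_mul_rank_companionMatrix_le (K := K) h₁ h₂ hS a ha g)
    refine le_rank_aeval_companionMatrix ha.ne_zero _ hg ?_
    rw [← hdegK, hgh, natDegree_mul hg (right_ne_zero_of_mul hne)]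
  have hmin : minpoly L (φ a) = m := by
    have hi : IsIntegral L (φ a) := Algebra.IsIntegral.isIntegral _
    obtain ⟨h, hh⟩ := minpoly.dvd L (φ a) hm0
    -- With g the minimal polynomial of φ(a) the rank is zero, so the cofactor `h` is constant.
    have h1 := hrank ((minpoly L (φ a)).map (algebraMap L K)) (h.map (algebraMap L K)) (by
      rw [← Polynomial.map_mul, ← hh])
    rw [hTaeval, minpoly.aeval, Matrix.map_zero _ (map_zero _), Matrix.rank_zero, mul_zero,
      natDegree_map] at h1
    have h2 : h.natDegree = 0 :=
      (Nat.mul_eq_zero.1 (Nat.le_zero.1 h1)).resolve_left Fintype.card_ne_zero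
    have hne : minpoly L (φ a) * h ≠ 0 := hh ▸ hmonic.ne_zero
    refine (eq_of_monic_of_dvd_of_natDegree_le (minpoly.monic hi) hmonic ⟨h, hh⟩ ?_).symm
    rw [hh, natDegree_mul (left_ne_zero_of_mul hne) (right_ne_zero_of_mul hne), h2, add_zero]
  refine ⟨hmin, ?_⟩
  obtain ⟨r, hr, h⟩ := charpoly_eq_pow_of_rank_le T (hmonic.map (algebraMap L K))
    (by rw [← hmK, hdegK]; exact ha.natDegree_pos)
    (by rw [hTaeval, hm0, Matrix.map_zero _ (map_zero _)]) hrank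
  refine ⟨r, hr, Polynomial.map_injective _ (algebraMap L K).injective ?_⟩
  rw [← Matrix.charpoly_map, hmin, Polynomial.map_pow]
  exact h

end Endgame

/-! ### Matrices of the bimodules P, P ⊗ P and P^d -/

section Bimodule

variable {L : Type*} [Field L] {P : Type*} [AddCommGroup P] [Module L P] [Module Lᵐᵒᵖ P]
  [SMulCommClass L Lᵐᵒᵖ P] {d : ℕ}

/-- The matrix representation of the right action in a left basis. -/
noncomputable def rightMatrix (b : Module.Basis (Fin d) L P) : L →+* Matrix (Fin d) (Fin d) L :=
  (LinearMap.toMatrixAlgEquiv b).toRingEquiv.toRingHom.comp (phi L P)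

theorem rightMatrix_apply (b : Module.Basis (Fin d) L P) (a : L) :
    rightMatrix b a = LinearMap.toMatrix b b (phi L P a) := rfl

theorem op_smul_basis (b : Module.Basis (Fin d) L P) (a : L) (j : Fin d) :
    op a • b j = ∑ k, rightMatrix b a k j • b k := by
  conv_lhs => rw [← b.sum_repr (op a • b j)]
  exact Finset.sum_congr rfl fun k _ => by
    rw [rightMatrix_apply, LinearMap.toMatrix_apply]
    rfl

/-- Expanding the second factor of a tensor in a left basis. -/
noncomputable def tensorCoord (b : Module.Basis (Fin d) L P) :
    BimodTensor L P P ≃+ (Fin d → P) :=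
  ((TensorProduct.equivFinsuppOfBasisRight (M := RightMod L P) b).trans
    (Finsupp.linearEquivFunOnFinite L (RightMod L P) (Fin d))).toAddEquiv

theorem tensorCoord_tmul (b : Module.Basis (Fin d) L P) (p q : P) (j : Fin d) :
    tensorCoord b (BimodTensor.tmul p q) j = op (b.repr q j) • p :=
  TensorProduct.equivFinsuppOfBasisRight_apply_tmul_apply (M := RightMod L P) b
    (RightMod.of L P p) q j

theorem BimodTensor.induction_on {motive : BimodTensor L P P → Prop} (t : BimodTensor L P P)
    (zero : motive 0) (tmul : ∀ p q, motive (BimodTensor.tmul p q))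
    (add : ∀ s t, motive s → motive t → motive (s + t)) : motive t :=
  TensorProduct.induction_on (M := RightMod L P) (motive := motive) t zero
    (fun p q => tmul ((RightMod.of L P).symm p) q) add

/-- `tensorCoord` as an equivalence of left modules. -/
noncomputable def tensorEquivPi (b : Module.Basis (Fin d) L P) :
    BimodTensor L P P ≃ₗ[L] (Fin d → P) :=
  { tensorCoord b with
    map_smul' := fun a t => by
      change tensorCoord b (a • t) = a • tensorCoord b t
      induction t using BimodTensor.induction_on with
      | zero => simp
      | tmul p q =>
        ext j
        rw [BimodTensor.smul_tmul, Pi.smul_apply, tensorCoord_tmul, tensorCoord_tmul,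
          smul_comm a (op _) p]
      | add s t hs ht => rw [smul_add, map_add, map_add, smul_add, hs, ht] }

theorem tensorEquivPi_tmul (b : Module.Basis (Fin d) L P) (p : P) (j : Fin d) :
    tensorEquivPi b (BimodTensor.tmul p (b j)) = Pi.single j p := by
  ext k
  refine (tensorCoord_tmul b p (b j) k).trans ?_
  rw [b.repr_self]
  rcases eq_or_ne k j with rfl | h
  · simp
  · simp [h]

/-- The basis of a power of `P` given by a basis of `P`. -/
noncomputable def piBasis (b : Module.Basis (Fin d) L P) :
    Module.Basis (Fin d × Fin d) L (Fin d → P) :=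
  .ofEquivFun ((LinearEquiv.piCongrRight fun _ : Fin d => b.equivFun).trans
    (LinearEquiv.curry L L (Fin d) (Fin d)).symm)

theorem piBasis_repr (b : Module.Basis (Fin d) L P) (v : Fin d → P) (j i : Fin d) :
    (piBasis b).repr v (j, i) = b.repr (v j) i := rfl

theorem piBasis_apply (b : Module.Basis (Fin d) L P) (j i : Fin d) :
    piBasis b (j, i) = Pi.single j (b i) := by
  apply (piBasis b).repr.injective
  ext ⟨k, l⟩
  rw [Module.Basis.repr_self, piBasis_repr]
  rcases eq_or_ne j k with rfl | h
  · simp [Finsupp.single_apply]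
  · simp [h.symm]

/-- The basis of pure tensors, indexed by the second factor and then the first one. -/
noncomputable def tensorBasis (b : Module.Basis (Fin d) L P) :
    Module.Basis (Fin d × Fin d) L (BimodTensor L P P) :=
  (piBasis b).map (tensorEquivPi b).symm

theorem tensorBasis_apply (b : Module.Basis (Fin d) L P) (j i : Fin d) :
    tensorBasis b (j, i) = BimodTensor.tmul (b i) (b j) := by
  rw [tensorBasis, Module.Basis.map_apply, LinearEquiv.symm_apply_eq, tensorEquivPi_tmul,
    piBasis_apply]

/-- Expand b_j a in the left basis, move the coefficients φ(a)_kj across the tensor sign, and expand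
b_i φ(a)_kj again; this second expansion applies φ to the entries. -/
theorem toMatrix_tensorBasis (b : Module.Basis (Fin d) L P) (a : L) :
    LinearMap.toMatrix (tensorBasis b) (tensorBasis b) (phi L (BimodTensor L P P) a) =
      blockExt (rightMatrix b) (rightMatrix b a) := by
  ext ⟨k, l⟩ ⟨j, i⟩
  rw [LinearMap.toMatrix_apply, tensorBasis_apply]
  have h : phi L (BimodTensor L P P) a (BimodTensor.tmul (b i) (b j)) =
      ∑ k, ∑ l, rightMatrix b (rightMatrix b a k j) l i • tensorBasis b (k, l) := by
    change op a • (BimodTensor.tmul (b i) (b j) : BimodTensor L P P) = _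
    rw [BimodTensor.op_smul_tmul, op_smul_basis]
    have h1 : ∀ v : Fin d → P, (BimodTensor.tmul (b i) (∑ k, v k) : BimodTensor L P P) =
        ∑ k, BimodTensor.tmul (b i) (v k) := fun v =>
      map_sum (TensorProduct.mk L (RightMod L P) P (RightMod.of L P (b i))) v Finset.univ
    have h2 : ∀ (v : Fin d → P) (q : P), (BimodTensor.tmul (∑ k, v k) q : BimodTensor L P P) =
        ∑ k, BimodTensor.tmul (v k) q := fun v q =>
      map_sum ((TensorProduct.mk L (RightMod L P) P).flip q) (fun k => RightMod.of L P (v k))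
        Finset.univ
    rw [h1]
    refine Finset.sum_congr rfl fun k _ => ?_
    rw [← BimodTensor.balanced, op_smul_basis, h2]
    refine Finset.sum_congr rfl fun l _ => ?_
    rw [tensorBasis_apply]
    rfl
  rw [h]
  simp only [map_sum, map_smul, Module.Basis.repr_self]
  simp only [Finsupp.finsetSum_apply, Finsupp.smul_apply, Finsupp.single_apply, Prod.mk.injEq,
    smul_eq_mul, mul_ite, mul_one, mul_zero, ite_and]
  simp [blockExt]

theorem toMatrix_piBasis (b : Module.Basis (Fin d) L P) (a : L) :
    LinearMap.toMatrix ((piBasis b).reindex (Equiv.prodComm _ _))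
      ((piBasis b).reindex (Equiv.prodComm _ _)) (phi L (Fin d → P) a) =
      blockDiagonal fun _ : Fin d => rightMatrix b a := by
  ext ⟨i, j⟩ ⟨k, l⟩
  rw [LinearMap.toMatrix_apply, Module.Basis.repr_reindex_apply, Module.Basis.reindex_apply]
  simp only [Equiv.prodComm_symm, Equiv.prodComm_apply, Prod.swap_prod_mk, piBasis_repr,
    piBasis_apply]
  change b.repr (op a • Pi.single (M := fun _ => P) l (b k) j) i = _
  rw [blockDiagonal_apply]
  rcases eq_or_ne j l with rfl | h
  · rw [Pi.single_eq_same, if_pos rfl, rightMatrix_apply, LinearMap.toMatrix_apply]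
    rfl
  · simp [h]

/-- The right action on P ⊗ P is written in two left bases: the pure tensors, and the basis of P^d
pulled back along the bimodule isomorphism. One change of basis serves all `a`. -/
theorem IsGalois.exists_conj (hP : IsGalois L d P) (b : Module.Basis (Fin d) L P) :
    ∃ S S' : Matrix (Fin d × Fin d) (Fin d × Fin d) L, S * S' = 1 ∧ S' * S = 1 ∧
      ∀ a, S * blockDiagonal (fun _ : Fin d => rightMatrix b a) =
        blockExt (rightMatrix b) (rightMatrix b a) * S := by
  obtain ⟨e, he, he'⟩ := hP.tensor_iso
  let E : BimodTensor L P P ≃ₗ[L] (Fin d → P) := { e with map_smul' := he }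
  let c₀ := (piBasis b).reindex (Equiv.prodComm _ _)
  let c := c₀.map E.symm
  refine ⟨(tensorBasis b).toMatrix c, c.toMatrix (tensorBasis b),
    (tensorBasis b).toMatrix_mul_toMatrix_flip c, c.toMatrix_mul_toMatrix_flip _, fun a => ?_⟩
  have hc : LinearMap.toMatrix c c (phi L (BimodTensor L P P) a) =
      blockDiagonal fun _ : Fin d => rightMatrix b a := by
    rw [← toMatrix_piBasis b a]
    ext i j
    rw [LinearMap.toMatrix_apply, LinearMap.toMatrix_apply]
    have : E (phi L (BimodTensor L P P) a (c j)) = phi L (Fin d → P) a (c₀ j) := by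
      refine (he' a (c j)).trans ?_
      change op a • E (c j) = op a • c₀ j
      rw [Module.Basis.map_apply, E.apply_symm_apply]
    rw [← this]
    rfl
  rw [← hc, ← toMatrix_tensorBasis, basis_toMatrix_mul_linearMap_toMatrix,
    linearMap_toMatrix_mul_basis_toMatrix]

theorem mem_center_of_mem_scalarField [Nonempty (Fin d)] (b : Module.Basis (Fin d) L P)
    (z : scalarField (rightMatrix b)) : (z : L) ∈ center L P := by
  intro x
  have h : rightMatrix b z = Matrix.scalar (Fin d) (z : L) := z.2
  have : phi L P z = (z : L) • LinearMap.id := by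
    apply (LinearMap.toMatrix b b).injective
    rw [← rightMatrix_apply, h, map_smul, LinearMap.toMatrix_id, Matrix.scalar_apply,
      Matrix.smul_one_eq_diagonal]
  exact (LinearMap.congr_fun this x).symm

end Bimodule

end GalBimod

theorem mainTheorem10 {L : Type*} [Field L] {P : Type*} [AddCommGroup P] [Module L P]
    [Module Lᵐᵒᵖ P] [SMulCommClass L Lᵐᵒᵖ P] [Module.Finite L P] {d : ℕ}
    (hP : GalBimod.IsGalois L d P) (a : L) :
    (∃ r : ℕ, 1 ≤ r ∧
      (GalBimod.phi L P a).charpoly = minpoly L (GalBimod.phi L P a) ^ r) ∧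
    (∀ i : ℕ, (GalBimod.phi L P a).charpoly.coeff i ∈ GalBimod.center L P) := by
  obtain ⟨e⟩ := hP.left_free
  have : Nonempty (Fin d) := Fin.pos_iff_nonempty.1 hP.one_le_rank
  let b : Module.Basis (Fin d) L P := Module.Basis.ofEquivFun e
  obtain ⟨S, S', h₁, h₂, hS⟩ := hP.exists_conj b
  obtain ⟨hmin, r, hr, h⟩ := GalBimod.charpoly_eq_minpoly_pow h₁ h₂ hS a
  have hchar : (GalBimod.rightMatrix b a).charpoly = (GalBimod.phi L P a).charpoly :=
    LinearMap.charpoly_toMatrix _ b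
  have hminp : minpoly L (GalBimod.rightMatrix b a) = minpoly L (GalBimod.phi L P a) :=
    LinearMap.minpoly_toMatrix b _
  refine ⟨⟨r, hr, by rw [← hchar, ← hminp, h]⟩, fun i => ?_⟩
  rw [← hchar, h, hmin, ← Polynomial.map_pow, Polynomial.coeff_map]
  exact GalBimod.mem_center_of_mem_scalarField b _
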